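/- An update family $\mathcal U$ is a finite collection of finite, non-empty subsets (rules) of $\mathbb Z^2\setminus\{0\}$. Given $A=A_0\subset\mathbb Z^2$, let $A_{t+1}=A_t\cup\{x\in\mathbb Z^2 : X+x\subset A_t \text{ for some } X\in\mathcal U\}$ for $t\ge 0$, and let $[A]=\bigcup_{t\ge 0}A_t$. For $u$ in the unit circle $S^1\subset\mathbb R^2$ let $\mathbb H_u=\{x\in\mathbb Z^2:\langle x,u\rangle<0\}$, and let the stable set of $\mathcal U$ be $\mathcal S=\{u\in S^1:[\mathbb H_u]=\mathbb H_u\}$. The family $\mathcal U$ is subcritical if every open semicircle of $S^1$ intersects the interior of $\mathcal S$ in $S^1$. For $p\in[0,1]$ let $\mathbb P_p$ be the law of the random set $A\subset\mathbb Z^2$ that contains each site independently with probability $p$, and let $p_c(\mathbb Z^2,\mathcal U)=\inf\{p\in[0,1]:\mathbb P_p([A]=\mathbb Z^2)=1\}$. Theorem. Let $\mathcal U$ be a subcritical update family. Then \[ \mathbb P_p\big(0\in[A]\big)\to 0\quad\text{as } p\to 0 . \] In particular, $p_c(\mathbb Z^2,\mathcal U)>0$. Furthermore, $p_c(\mathbb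 Z^2,\mathcal U)=1$ if and only if $\mathcal S=S^1$. -/

import Mathlib

open MeasureTheory ProbabilityTheory Filter Topology unitInterval

namespace Bootstrap

/-- The sites of the square lattice `ℤ²`. -/
abbrev Site : Type := Fin 2 → ℤ

/-- A two-dimensional update family: a finite collection of finite, non-empty
subsets of `ℤ² \ {0}`, called the update rules. -/
structure UpdateFamily where
  rules : Finset (Finset Site)
  nonempty_of_mem : ∀ X ∈ rules, X.Nonempty
  zero_notMem_of_mem : ∀ X ∈ rules, (0 : Site) ∉ X

/-- One step of the dynamics: every infected site stays infected, and a site `x` becomes infected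
when `X + x` is fully infected for some update rule `X`. -/
def step (U : UpdateFamily) (A : Set Site) : Set Site :=
  A ∪ {x | ∃ X ∈ U.rules, ∀ y ∈ X, y + x ∈ A}

/-- The set `A_t` of sites infected by time `t`, started from `A_0 = A`. -/
def infected (U : UpdateFamily) (A : Set Site) : ℕ → Set Site
  | 0 => A
  | t + 1 => step U (infected U A t)

/-- The closure `[A] = ⋃ₜ A_t`: the set of all eventually infected sites. -/
def closure (U : UpdateFamily) (A : Set Site) : Set Site :=
  ⋃ t : ℕ, infected U A t

/-- The unit circle in the Euclidean plane, with its subspace topology. -/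
abbrev Circle : Type := Metric.sphere (0 : EuclideanSpace ℝ (Fin 2)) 1

/-- The embedding of `ℤ²` in the Euclidean plane. -/
def toPlane (x : Site) : EuclideanSpace ℝ (Fin 2) :=
  WithLp.toLp 2 fun i => (x i : ℝ)

/-- The discrete half plane `{x ∈ ℤ² : ⟨x, u⟩ < 0}`. -/
def halfPlane (u : Circle) : Set Site :=
  {x | inner ℝ (toPlane x) (u : EuclideanSpace ℝ (Fin 2)) < 0}

/-- The stable set: the directions `u` with `[ℍ_u] = ℍ_u`. -/
def stableSet (U : UpdateFamily) : Set Circle :=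
  {u | closure U (halfPlane u) = halfPlane u}

/-- The open semicircle centred at `w`. -/
def openSemicircle (w : Circle) : Set Circle :=
  {v | 0 < inner ℝ (v : EuclideanSpace ℝ (Fin 2)) (w : EuclideanSpace ℝ (Fin 2))}

/-- An update family is subcritical if every open semicircle meets the interior (relative to the
circle) of the stable set. -/
def UpdateFamily.IsSubcritical (U : UpdateFamily) : Prop :=
  ∀ w : Circle, (openSemicircle w ∩ interior (stableSet U)).Nonempty

/-- The law `ℙ_p` of a `p`-random subset of `ℤ²`: every site is included independently with
probability `p`. -/
noncomputable def law (p : I) : Measure (Set Site) :=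
  setBernoulli Set.univ p

/-- The critical probability: the infimum of those `p ∈ [0, 1]` for which a `p`-random set
percolates almost surely. (The set contains `1` and is bounded below by `0`.) -/
noncomputable def criticalProbability (U : UpdateFamily) : ℝ :=
  sInf {q : ℝ | ∃ p : I, (p : ℝ) = q ∧ ∀ᵐ A ∂(law p), closure U A = Set.univ}

end Bootstrap

/-! Subcriticality puts the origin in the convex hull of the open cone of directions `v` such that
every rule has a site `y` with `⟨y, v⟩ > 0` (`zero_mem_convexHull`). A vanishing convex combination
of such directions gives finitely many linear potentials, one per charge, that sum to zero and are
each positive somewhere on every rule (`exists_eroder`).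

These potentials drive a Toom-type Peierls argument. From an infected site outside `A` there is, for
every charge, an arrow to a site infected earlier whose potential is larger by a fixed amount, so
arrows end in `A`. Since the potentials cancel when all charges meet at the same seeds, the total
length of suitably matched arrow paths is at most a constant times the number of seeds reached
(`exists_toomMatching`, `exists_explores_seeds`). Hence `0 ∈ [A]` forces a walk from the origin
whose length is at most proportional to the number of distinct sites of `A` it visits. There are
exponentially many such walks, so a union bound gives a geometric series in `p`
(`law_le_of_explores`), which tends to `0`; this also yields `p_c > 0`.

If every direction is stable, each rule has the origin in its convex hull, and the lattice points of
a zonotope form a finite set that stays healthy once initially healthy (`exists_add_mem_zonotope`);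
so `p_c = 1`. If some direction is unstable, some rule lies in an open half-plane, and a site that
is never infected starts arbitrarily long self-avoiding healthy paths, which is impossible almost
surely for `p` near `1`; so `p_c < 1`. -/

namespace Bootstrap

/-! ### Arrow systems, blocks and Toom matchings. -/

/-- A finite-height system of arrows on a set of sites: every site of the carrier that is not a seed
has, for each charge `s`, an arrow to a site of smaller rank, along which the potential of
charge `s` grows by at least `gain`, while the potentials of all charges sum to zero. -/
structure ArrowSystem (V ι : Type) [AddCommGroup V] [Fintype ι] where
  seeds : Set V
  carrier : Set V
  rank : V → ℕ
  height : ℕ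
  next : ι → V → V
  steps : Set V
  pot : ι → V →+ ℝ
  gain : ℝ
  bound : ℝ
  rank_le : ∀ v ∈ carrier, rank v ≤ height
  next_of_seed : ∀ s, ∀ v ∈ seeds, next s v = v
  next_mem : ∀ s, ∀ v ∈ carrier, next s v ∈ carrier
  rank_next_lt : ∀ s, ∀ v ∈ carrier, v ∉ seeds → rank (next s v) < rank v
  neg_mem : ∀ d ∈ steps, -d ∈ steps
  next_sub_mem : ∀ s, ∀ v ∈ carrier, next s v - v ∈ steps
  sibling_mem : ∀ s s', ∀ v ∈ carrier, next s v - next s' v ∈ steps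
  gain_pos : 0 < gain
  gain_le : ∀ s, ∀ v ∈ carrier, v ∉ seeds → gain ≤ pot s (next s v) - pot s v
  bound_nonneg : 0 ≤ bound
  pot_le : ∀ s, ∀ d ∈ steps, |pot s d| ≤ bound
  sum_pot : ∀ v, ∑ s, pot s v = 0

namespace ArrowSystem

/-- The reindexing used to join two rooted families along a new row attached to the root of the
second one. -/
def joinLeft {R₁ R₂ : Type} : Option (R₁ ⊕ Option R₂) → Option R₁ ⊕ Option R₂
  | none => .inl none
  | some (.inl r) => .inl (some r)
  | some (.inr o) => .inr o

/-- The reindexing used to join two rooted families along a new row attached to the root of the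
first one. -/
def joinRight {R₁ R₂ : Type} : Option (R₁ ⊕ Option R₂) → Option R₁ ⊕ Option R₂
  | none => .inr none
  | some (.inl r) => .inl (some r)
  | some (.inr none) => .inl none
  | some (.inr (some r)) => .inr (some r)

lemma bijective_joinLeft {R₁ R₂ : Type} : Function.Bijective (@joinLeft R₁ R₂) := by
  constructor
  · rintro (_ | _ | _) (_ | _ | _) h <;> simp_all [joinLeft]
  · rintro ((_ | r) | o)
    exacts [⟨none, rfl⟩, ⟨some (.inl r), rfl⟩, ⟨some (.inr o), rfl⟩]

lemma bijective_joinRight {R₁ R₂ : Type} : Function.Bijective (@joinRight R₁ R₂) := by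
  constructor
  · rintro (_ | _ | _ | _) (_ | _ | _ | _) h <;> simp_all [joinRight]
  · rintro ((_ | r) | (_ | r))
    exacts [⟨some (.inr none), rfl⟩, ⟨some (.inl r), rfl⟩, ⟨none, rfl⟩, ⟨some (.inr (some r)), rfl⟩]

lemma range_sumElim_comp {V α β γ : Type} [DecidableEq V] {B₁ B₂ : Finset V} (hB : Disjoint B₁ B₂)
    {e₁ : α → V} {e₂ : β → V} (h₁ : Function.Injective e₁) (h₂ : Function.Injective e₂)
    (r₁ : Set.range e₁ = B₁) (r₂ : Set.range e₂ = B₂) {φ : γ → α ⊕ β}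
    (hφ : Function.Bijective φ) {e : γ → V} (he : ∀ x, e x = Sum.elim e₁ e₂ (φ x)) :
    Function.Injective e ∧ Set.range e = ↑(B₁ ∪ B₂) := by
  obtain rfl : e = Sum.elim e₁ e₂ ∘ φ := funext he
  refine ⟨Function.Injective.comp (h₁.sumElim h₂ fun a b hab => ?_) hφ.1, ?_⟩
  · have ha : e₁ a ∈ B₁ := by rw [← Finset.mem_coe, ← r₁]; exact ⟨a, rfl⟩
    have hb : e₂ b ∈ B₂ := by rw [← Finset.mem_coe, ← r₂]; exact ⟨b, rfl⟩
    exact Finset.disjoint_left.1 hB ha (hab ▸ hb)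
  · rw [hφ.2.range_comp, Set.Sum.elim_range, r₁, r₂, Finset.coe_union]

/-- Every member of `F` is contained in a member of `F'`. -/
def Coarsens {V : Type} (F F' : Set (Finset V)) : Prop := ∀ B ∈ F, ∃ B' ∈ F', B ⊆ B'

lemma Coarsens.refl {V : Type} (F : Set (Finset V)) : Coarsens F F := fun B hB => ⟨B, hB, subset_rfl⟩

lemma Coarsens.trans {V : Type} {F₁ F₂ F₃ : Set (Finset V)} (h : Coarsens F₁ F₂) (h' : Coarsens F₂ F₃) :
    Coarsens F₁ F₃ := fun B hB =>
  let ⟨B', hB', hs⟩ := h B hB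
  let ⟨B'', hB'', hs'⟩ := h' B' hB'
  ⟨B'', hB'', hs.trans hs'⟩

variable {V ι : Type} [AddCommGroup V] [Fintype ι] (G : ArrowSystem V ι)

/-- The seed reached from `v` by following the arrows of charge `s`. -/
def terminal (s : ι) (v : V) : V := (G.next s)^[G.height] v

lemma iterate_mem_seeds (s : ι) (n : ℕ) : ∀ v ∈ G.carrier, G.rank v ≤ n →
    (G.next s)^[n] v ∈ G.seeds := by
  induction n with
  | zero =>
    intro v hv h
    by_contra hs
    have := G.rank_next_lt s v hv hs
    omega
  | succ n ih =>
    intro v hv h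
    rw [Function.iterate_succ_apply]
    by_cases hs : v ∈ G.seeds
    · rw [G.next_of_seed s v hs, Function.iterate_fixed (G.next_of_seed s v hs)]
      exact hs
    · have := G.rank_next_lt s v hv hs
      exact ih _ (G.next_mem s v hv) (by omega)

lemma terminal_mem_seeds (s : ι) {v : V} (hv : v ∈ G.carrier) : G.terminal s v ∈ G.seeds :=
  G.iterate_mem_seeds s _ v hv (G.rank_le v hv)

lemma terminal_of_seed (s : ι) {v : V} (hv : v ∈ G.seeds) : G.terminal s v = v :=
  Function.iterate_fixed (G.next_of_seed s v hv) _

lemma terminal_next (s : ι) {v : V} (hv : v ∈ G.carrier) :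
    G.terminal s (G.next s v) = G.terminal s v := by
  unfold terminal
  rw [← Function.iterate_succ_apply, Function.iterate_succ_apply']
  exact G.next_of_seed s _ (G.terminal_mem_seeds s hv)

/-- A finite set of seeds is a block if there is a family of pairs of adjacent sites, its rows, such
that, for every charge and every choice of a root in the block, one entry of each row can be chosen
so that the chosen entries lead bijectively to the seeds of the block other than the root. -/
def IsBlock (B : Finset V) : Prop :=
  ∃ (R : Type) (_ : Fintype R) (row : R → V × V),
    (∀ r, (row r).1 ∈ G.carrier ∧ (row r).2 ∈ G.carrier ∧ (row r).1 - (row r).2 ∈ G.steps) ∧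
    ∀ s, ∀ b ∈ B, ∃ w : R → V, (∀ r, w r = (row r).1 ∨ w r = (row r).2) ∧
      Function.Injective (fun o : Option R => o.elim b fun r => G.terminal s (w r)) ∧
      Set.range (fun o : Option R => o.elim b fun r => G.terminal s (w r)) = B

lemma isBlock_singleton (b : V) : G.IsBlock {b} := by
  refine ⟨Empty, inferInstance, Empty.elim, fun r => r.elim, fun s b' hb' => ?_⟩
  obtain rfl : b' = b := by simpa using hb'
  refine ⟨Empty.elim, fun r => r.elim, ?_, ?_⟩
  · rintro (_ | ⟨⟨⟩⟩) (_ | ⟨⟨⟩⟩) _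
    rfl
  · ext x
    constructor
    · rintro ⟨_ | ⟨⟨⟩⟩, rfl⟩
      simp
    · intro hx
      exact ⟨none, by simpa [eq_comm] using hx⟩

/-- The new row `(c, c')` supplies the missing root of the block that does not contain the
prescribed root: with the root in `B₁` its entry `c'` leads to a root of `B₂`, and with the root in
`B₂` its entry `c` leads to a root of `B₁`. -/
lemma IsBlock.union [DecidableEq V] {B₁ B₂ : Finset V} (h₁ : G.IsBlock B₁) (h₂ : G.IsBlock B₂)
    (hB : Disjoint B₁ B₂) {c c' : V} (hc : c ∈ G.carrier) (hc' : c' ∈ G.carrier)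
    (hcc : c - c' ∈ G.steps) (hcB : ∀ s, G.terminal s c ∈ B₁) (hcB' : ∀ s, G.terminal s c' ∈ B₂) :
    G.IsBlock (B₁ ∪ B₂) := by
  obtain ⟨R₁, _, row₁, hrow₁, H₁⟩ := h₁
  obtain ⟨R₂, _, row₂, hrow₂, H₂⟩ := h₂
  refine ⟨R₁ ⊕ Option R₂, inferInstance, Sum.elim row₁ fun o => o.elim (c, c') row₂, ?_, ?_⟩
  · rintro (r | _ | r)
    exacts [hrow₁ r, ⟨hc, hc', hcc⟩, hrow₂ r]
  intro s b hb
  rcases Finset.mem_union.1 hb with hb | hb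
  · obtain ⟨w₁, hw₁, i₁, r₁⟩ := H₁ s b hb
    obtain ⟨w₂, hw₂, i₂, r₂⟩ := H₂ s _ (hcB' s)
    refine ⟨Sum.elim w₁ fun o => o.elim c' w₂, ?_,
      range_sumElim_comp hB i₁ i₂ r₁ r₂ bijective_joinLeft ?_⟩
    · rintro (r | _ | r)
      exacts [hw₁ r, Or.inr rfl, hw₂ r]
    · rintro (_ | _ | _ | _) <;> rfl
  · obtain ⟨w₁, hw₁, i₁, r₁⟩ := H₁ s _ (hcB s)
    obtain ⟨w₂, hw₂, i₂, r₂⟩ := H₂ s b hb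
    refine ⟨Sum.elim w₁ fun o => o.elim c w₂, ?_,
      range_sumElim_comp hB i₁ i₂ r₁ r₂ bijective_joinRight ?_⟩
    · rintro (r | _ | r)
      exacts [hw₁ r, Or.inl rfl, hw₂ r]
    · rintro (_ | _ | _ | _) <;> rfl

/-- A family of pairwise disjoint blocks. -/
def IsFamily (F : Set (Finset V)) : Prop :=
  F.PairwiseDisjoint id ∧ ∀ B ∈ F, G.IsBlock B

/-- All the seeds reached from `v` lie in one member of the family. -/
def Covers (F : Set (Finset V)) (v : V) : Prop := ∃ B ∈ F, ∀ s, G.terminal s v ∈ B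

variable {G} in
lemma Covers.mono {F F' : Set (Finset V)} {v : V} (h : G.Covers F v) (hF : Coarsens F F') :
    G.Covers F' v :=
  let ⟨B, hB, hs⟩ := h
  let ⟨B', hB', hs'⟩ := hF B hB
  ⟨B', hB', fun s => hs' (hs s)⟩

lemma exists_family_merge {F : Set (Finset V)} (hF : G.IsFamily F) {c c' : V}
    (hc : c ∈ G.carrier) (hc' : c' ∈ G.carrier) (hcc : c - c' ∈ G.steps)
    (h : G.Covers F c) (h' : G.Covers F c') :
    ∃ F', G.IsFamily F' ∧ Coarsens F F' ∧
      ∃ B ∈ F', ∀ s, G.terminal s c ∈ B ∧ G.terminal s c' ∈ B := by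
  classical
  obtain ⟨B, hB, hcB⟩ := h
  obtain ⟨B', hB', hcB'⟩ := h'
  by_cases hBB : B = B'
  · subst hBB
    exact ⟨F, hF, Coarsens.refl F, B, hB, fun s => ⟨hcB s, hcB' s⟩⟩
  have hd : Disjoint B B' := hF.1 hB hB' hBB
  refine ⟨insert (B ∪ B') (F \ {B, B'}), ⟨?_, ?_⟩, ?_, B ∪ B', Set.mem_insert _ _, fun s =>
    ⟨Finset.mem_union_left _ (hcB s), Finset.mem_union_right _ (hcB' s)⟩⟩
  · refine (hF.1.subset Set.sdiff_subset).insert fun X hX _ => ?_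
    have h1 : X ≠ B := fun h => hX.2 (by simp [h])
    have h2 : X ≠ B' := fun h => hX.2 (by simp [h])
    exact Finset.disjoint_union_left.2 ⟨hF.1 hB hX.1 h1.symm, hF.1 hB' hX.1 h2.symm⟩
  · rintro X (rfl | hX)
    · exact IsBlock.union G (hF.2 B hB) (hF.2 B' hB') hd hc hc' hcc hcB hcB'
    · exact hF.2 X hX.1
  · intro X hX
    by_cases h1 : X = B
    · exact ⟨_, Set.mem_insert _ _, h1 ▸ Finset.subset_union_left⟩
    by_cases h2 : X = B'
    · exact ⟨_, Set.mem_insert _ _, h2 ▸ Finset.subset_union_right⟩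
    · exact ⟨X, Set.mem_insert_of_mem _ ⟨hX, by simp [h1, h2]⟩, subset_rfl⟩

/-- Induction on the rank: cover the arrow targets of `v` one charge at a time, then merge the
blocks covering them, which is possible because siblings differ by a step. The seed reached from `v`
with charge `s` is the one reached from its `s`-target, so the merged block covers `v`. -/
lemma exists_family_covers [Nonempty ι] (n : ℕ) : ∀ v ∈ G.carrier, G.rank v ≤ n →
    ∀ F, G.IsFamily F → ∃ F', G.IsFamily F' ∧ Coarsens F F' ∧ G.Covers F' v := by
  classical
  induction n using Nat.strong_induction_on with
  | _ n ih =>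
  intro v hv hn F hF
  by_cases hs : v ∈ G.seeds
  · by_cases hB : ∃ B ∈ F, v ∈ B
    · obtain ⟨B, hB, hvB⟩ := hB
      exact ⟨F, hF, Coarsens.refl F, B, hB, fun s => by rwa [G.terminal_of_seed s hs]⟩
    · push Not at hB
      refine ⟨insert {v} F, ⟨?_, ?_⟩, fun B hB => ⟨B, Set.mem_insert_of_mem _ hB, subset_rfl⟩,
        {v}, Set.mem_insert _ _, fun s => by simp [G.terminal_of_seed s hs]⟩
      · exact hF.1.insert fun B hBF _ => Finset.disjoint_singleton_left.2 (hB B hBF)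
      · rintro B (rfl | hBF)
        exacts [G.isBlock_singleton v, hF.2 B hBF]
  have hchildren : ∀ t : Finset ι, ∃ F', G.IsFamily F' ∧ Coarsens F F' ∧
      ∀ s ∈ t, G.Covers F' (G.next s v) := by
    intro t
    induction t using Finset.induction_on with
    | empty => exact ⟨F, hF, Coarsens.refl F, by simp⟩
    | insert s t _ iht =>
      obtain ⟨F₁, hF₁, hFF₁, hcov⟩ := iht
      have := G.rank_next_lt s v hv hs
      obtain ⟨F₂, hF₂, hFF₂, hcov₂⟩ :=
        ih _ (this.trans_le hn) _ (G.next_mem s v hv) le_rfl F₁ hF₁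
      refine ⟨F₂, hF₂, hFF₁.trans hFF₂, fun s' hs' => ?_⟩
      rcases Finset.mem_insert.1 hs' with rfl | hs'
      exacts [hcov₂, (hcov s' hs').mono hFF₂]
  obtain ⟨F₁, hF₁, hFF₁, hcov⟩ := hchildren Finset.univ
  let s₀ : ι := Classical.arbitrary ι
  have hmerge : ∀ t : Finset ι, ∃ F', G.IsFamily F' ∧ Coarsens F₁ F' ∧
      ∃ B ∈ F', ∀ s ∈ insert s₀ t, ∀ s', G.terminal s' (G.next s v) ∈ B := by
    intro t
    induction t using Finset.induction_on with
    | empty =>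
      obtain ⟨B, hB, hs'⟩ := hcov s₀ (Finset.mem_univ _)
      exact ⟨F₁, hF₁, Coarsens.refl F₁, B, hB, by simpa using hs'⟩
    | insert s t _ iht =>
      obtain ⟨F₂, hF₂, hFF₂, B, hB, hBt⟩ := iht
      obtain ⟨F₃, hF₃, hFF₃, C, hC, hCs⟩ := G.exists_family_merge hF₂
        (G.next_mem s₀ v hv) (G.next_mem s v hv) (G.sibling_mem s₀ s v hv)
        ⟨B, hB, hBt s₀ (Finset.mem_insert_self _ _)⟩
        ((hcov s (Finset.mem_univ _)).mono hFF₂)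
      obtain ⟨B', hB', hBB'⟩ := hFF₃ B hB
      have hCB : C = B' := by
        by_contra hne
        exact Finset.disjoint_left.1 (hF₃.1 hC hB' hne) (hCs s₀).1
          (hBB' (hBt s₀ (Finset.mem_insert_self _ _) s₀))
      subst hCB
      refine ⟨F₃, hF₃, hFF₂.trans hFF₃, C, hC, fun s'' hs'' s' => ?_⟩
      rw [Finset.insert_comm] at hs''
      rcases Finset.mem_insert.1 hs'' with rfl | hs''
      exacts [(hCs s').2, hBB' (hBt s'' hs'' s')]
  obtain ⟨F₂, hF₂, hFF₂, B, hB, hBt⟩ := hmerge Finset.univ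
  refine ⟨F₂, hF₂, hFF₁.trans hFF₂, B, hB, fun s => ?_⟩
  rw [← G.terminal_next s hv]
  exact hBt s (by simp) s

/-- Existence of a Toom matching rooted at `v`. -/
lemma exists_toomMatching [Nonempty ι] {v : V} (hv : v ∈ G.carrier) :
    ∃ (B : Finset V) (R : Type) (_ : Fintype R) (w : ι → Option R → V),
      (∀ s, w s none = v) ∧ (∀ s o, w s o ∈ G.carrier) ∧
      (∀ s s' o, w s o = w s' o ∨ w s o - w s' o ∈ G.steps) ∧
      ∀ s, Function.Injective (fun o => G.terminal s (w s o)) ∧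
        Set.range (fun o => G.terminal s (w s o)) = B := by
  -- The root for charge `s` is the seed reached from `v` itself, so `v` becomes the entry of the
  -- extra row `none` for every charge.
  obtain ⟨F, hF, -, B, hB, hvB⟩ := G.exists_family_covers _ v hv le_rfl ∅ ⟨by simp, by simp⟩
  obtain ⟨R, hR, row, hrow, H⟩ := hF.2 B hB
  choose w hw hwi hwr using fun s => H s _ (hvB s)
  have key : ∀ s, (fun o : Option R => o.elim (G.terminal s v) fun r => G.terminal s (w s r)) =
      fun o : Option R => G.terminal s (o.elim v (w s)) := by
    intro s
    funext o
    cases o <;> rfl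
  refine ⟨B, R, hR, fun s o => o.elim v (w s), fun s => rfl, ?_, ?_, fun s => ?_⟩
  · rintro s (_ | r)
    · exact hv
    · rcases hw s r with h | h
      · simpa [h] using (hrow r).1
      · simpa [h] using (hrow r).2.1
  · rintro s s' (_ | r)
    · exact Or.inl rfl
    · have h3 := (hrow r).2.2
      have h4 := G.neg_mem _ h3
      rw [neg_sub] at h4
      rcases hw s r with h | h <;> rcases hw s' r with h' | h' <;> simp [h, h', h3, h4]
  · rw [← key s]
    exact ⟨hwi s, hwr s⟩

end ArrowSystem

/-! ### Walks that explore the seeds of an arrow system. -/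

/-- There is a walk of `2 * n` steps in `S` from the origin that visits all points of `P`. -/
def Explores {V : Type} [AddCommGroup V] (S : Set V) (n : ℕ) (P : Set V) : Prop :=
  ∃ l : List V, (∀ d ∈ l, d ∈ S) ∧ l.length = 2 * n ∧ ∀ p ∈ P, ∃ l₁, l₁ <+: l ∧ l₁.sum = p

lemma explores_zero {V : Type} [AddCommGroup V] (S : Set V) : Explores S 0 {0} :=
  ⟨[], by simp, rfl, by simp⟩

/-- Cut the walk at a visit to `x` and insert the detour from `x` to `y` and back. The detour sums
to zero, so all later positions are unchanged. -/
lemma Explores.insert {V : Type} [AddCommGroup V] {S : Set V} (hS : ∀ d ∈ S, -d ∈ S) {n : ℕ}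
    {P : Set V} (h : Explores S n P) {x y : V} (hx : x ∈ P) (hxy : y - x ∈ S) :
    Explores S (n + 1) (insert y P) := by
  obtain ⟨l, hl, hlen, hP⟩ := h
  obtain ⟨l₁, ⟨l₂, rfl⟩, rfl⟩ := hP x hx
  have hyx : l₁.sum - y ∈ S := by simpa using hS _ hxy
  refine ⟨l₁ ++ ([y - l₁.sum, l₁.sum - y] ++ l₂), ?_, ?_, ?_⟩
  · intro d hd
    simp only [List.mem_append, List.mem_cons, List.not_mem_nil, or_false] at hd
    rcases hd with hd | (rfl | rfl) | hd
    exacts [hl d (by simp [hd]), hxy, hyx, hl d (by simp [hd])]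
  · simp only [List.length_append, List.length_cons, List.length_nil] at hlen ⊢
    omega
  · rintro p (rfl | hp)
    · exact ⟨l₁ ++ [p - l₁.sum], ⟨[l₁.sum - p] ++ l₂, by simp⟩, by simp⟩
    · obtain ⟨m, hm, rfl⟩ := hP p hp
      have hl₁ : l₁ <+: l₁ ++ l₂ := List.prefix_append l₁ l₂
      rcases le_total m.length l₁.length with h | h
      · exact ⟨m, (List.prefix_of_prefix_length_le hm hl₁ h).trans (List.prefix_append _ _), rfl⟩
      · obtain ⟨m₂, rfl⟩ := List.prefix_of_prefix_length_le hl₁ hm h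
        obtain ⟨m₃, rfl⟩ := (List.prefix_append_right_inj l₁).1 hm
        refine ⟨l₁ ++ ([y - l₁.sum, l₁.sum - y] ++ m₂), ⟨m₃, by simp⟩, ?_⟩
        simp only [List.sum_append, List.sum_cons, List.sum_nil]
        abel

namespace ArrowSystem

variable {V ι : Type} [AddCommGroup V] [Fintype ι] (G : ArrowSystem V ι)

/-- Here `m` counts the arrows followed before a seed is met, each of which raises the potential by
at least `gain`. The same path can be explored from either end. -/
lemma exists_explores_iterate (s : ι) {v : V} (hv : v ∈ G.carrier) (k : ℕ) :
    ∃ m : ℕ, G.gain * m ≤ G.pot s ((G.next s)^[k] v) - G.pot s v ∧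
      ∀ n P, Explores G.steps n P →
        (v ∈ P → ∃ P', P ⊆ P' ∧ (G.next s)^[k] v ∈ P' ∧ Explores G.steps (n + m) P') ∧
        ((G.next s)^[k] v ∈ P → ∃ P', P ⊆ P' ∧ v ∈ P' ∧ Explores G.steps (n + m) P') := by
  induction k generalizing v with
  | zero => exact ⟨0, by simp, fun n P h =>
      ⟨fun hv => ⟨P, subset_rfl, hv, h⟩, fun hv => ⟨P, subset_rfl, hv, h⟩⟩⟩
  | succ k ih =>
    simp only [Function.iterate_succ_apply]
    by_cases hs : v ∈ G.seeds
    · rw [G.next_of_seed s v hs]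
      exact ih hv
    obtain ⟨m, hm, H⟩ := ih (G.next_mem s v hv)
    have hg := G.gain_le s v hv hs
    have hd := G.next_sub_mem s v hv
    refine ⟨m + 1, by push_cast; linarith, fun n P h => ⟨fun hvP => ?_, fun hvP => ?_⟩⟩
    · obtain ⟨P', hPP', hmem, hE⟩ :=
        (H (n + 1) _ (h.insert G.neg_mem hvP hd)).1 (Set.mem_insert _ _)
      exact ⟨P', (Set.subset_insert _ _).trans hPP', hmem, by convert hE using 1; omega⟩
    · obtain ⟨P', hPP', hmem, hE⟩ := (H n P h).2 hvP
      refine ⟨insert v P', hPP'.trans (Set.subset_insert _ _), Set.mem_insert _ _, ?_⟩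
      exact hE.insert G.neg_mem hmem (by simpa using G.neg_mem _ hd)

lemma pot_le_pot_terminal (s : ι) {v : V} (hv : v ∈ G.carrier) :
    0 ≤ G.pot s (G.terminal s v) - G.pot s v := by
  obtain ⟨m, hm, -⟩ := G.exists_explores_iterate s hv G.height
  exact le_trans (mul_nonneg G.gain_pos.le m.cast_nonneg) hm

/-- From the visited entry `w s₀` of a row, hop to each entry `w s` and follow its arrows to a seed;
the hop accounts for the extra `gain` per charge. -/
lemma exists_explores_star {w : ι → V} (hw : ∀ s, w s ∈ G.carrier)
    (hww : ∀ s s', w s = w s' ∨ w s - w s' ∈ G.steps) {n : ℕ} {P : Set V}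
    (h : Explores G.steps n P) {s₀ : ι} (h₀ : w s₀ ∈ P) :
    ∃ n' P', P ⊆ P' ∧ Explores G.steps n' P' ∧ (∀ s, G.terminal s (w s) ∈ P') ∧
      G.gain * n' ≤ G.gain * n +
        ∑ s, (G.pot s (G.terminal s (w s)) - G.pot s (w s) + G.gain) := by
  classical
  suffices H : ∀ t : Finset ι, ∃ n' P', P ⊆ P' ∧ Explores G.steps n' P' ∧
      (∀ s ∈ t, G.terminal s (w s) ∈ P') ∧ G.gain * n' ≤ G.gain * n +
        ∑ s ∈ t, (G.pot s (G.terminal s (w s)) - G.pot s (w s) + G.gain) by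
    simpa using H Finset.univ
  intro t
  induction t using Finset.induction_on with
  | empty => exact ⟨n, P, subset_rfl, h, by simp, by simp⟩
  | insert s t hst ih =>
    obtain ⟨n₁, P₁, hP₁, hE₁, ht₁, hn₁⟩ := ih
    have hE₂ : Explores G.steps (n₁ + 1) (insert (w s) P₁) := by
      refine hE₁.insert G.neg_mem (hP₁ h₀) ?_
      rcases hww s s₀ with heq | hstep
      -- The hop is then the zero step, which is a step as the difference of a sibling with itself.
      · simpa [heq] using G.sibling_mem s s _ (hw s)
      · exact hstep
    obtain ⟨m, hm, H⟩ := G.exists_explores_iterate s (hw s) G.height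
    obtain ⟨P₃, hP₃, hmem, hE₃⟩ := (H _ _ hE₂).1 (Set.mem_insert _ _)
    have hsub : P₁ ⊆ P₃ := (Set.subset_insert _ _).trans hP₃
    refine ⟨n₁ + 1 + m, P₃, hP₁.trans hsub, hE₃, ?_, ?_⟩
    · intro s' hs'
      rcases Finset.mem_insert.1 hs' with rfl | hs'
      exacts [hmem, hsub (ht₁ s' hs')]
    · rw [Finset.sum_insert hst]
      push_cast
      unfold terminal at *
      linarith

/-- A walk from the origin that visits a number of seeds proportional to its length. -/
theorem exists_explores_seeds [Nonempty ι] (h0 : (0 : V) ∈ G.carrier) :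
    ∃ (n : ℕ) (B : Finset V), 1 ≤ B.card ∧ (B : Set V) ⊆ G.seeds ∧ Explores G.steps n B ∧
      G.gain * n ≤ B.card * (Fintype.card ι * (2 * G.bound + G.gain)) := by
  classical
  obtain ⟨B, R, _, w, hw0, hwc, hww, hB⟩ := G.exists_toomMatching h0
  let f : ι → Option R → V := fun s o => G.terminal s (w s o)
  -- The factor 2 allows for one arrow path of the row being explored twice: backwards from a known
  -- seed to enter the row, and again within the star.
  let cost : Option R → ℝ := fun o => ∑ s, (2 * (G.pot s (f s o) - G.pot s (w s o)) + G.gain)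
  let good : Finset (Option R) → Prop := fun K => none ∈ K ∧ ∃ n P, Explores G.steps n P ∧
    (∀ o ∈ K, ∀ s, f s o ∈ P) ∧ G.gain * n ≤ ∑ o ∈ K, cost o
  have hnn : ∀ s o, 0 ≤ G.pot s (f s o) - G.pot s (w s o) := fun s o =>
    G.pot_le_pot_terminal s (hwc s o)
  have hgood : good {none} := by
    obtain ⟨n, P, -, hE, hP, hn⟩ := G.exists_explores_star (fun s => hwc s none)
      (fun s s' => hww s s' none) (explores_zero G.steps) (s₀ := Classical.arbitrary ι)
      (by simp [hw0])
    refine ⟨by simp, n, P, hE, by simpa using hP, ?_⟩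
    rw [Finset.sum_singleton]
    rw [Nat.cast_zero, mul_zero, zero_add] at hn
    refine hn.trans (Finset.sum_le_sum fun s _ => ?_)
    have := hnn s none
    simp only [f] at this ⊢
    linarith
  -- Rows of the matching need not all be connected to the origin. A maximal explored set `K` is
  -- closed under sharing a seed, so the cancellation of potentials can be carried out on `K` alone.
  obtain ⟨K, ⟨hnone, n, P, hE, hP, hn⟩, hmax⟩ :=
    (Set.toFinite {K | good K}).exists_maximal ⟨_, hgood⟩
  have hclosed : ∀ o ∈ K, ∀ s o' s', f s o = f s' o' → o' ∈ K := by
    intro o ho s o' s' hoo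
    by_contra ho'
    obtain ⟨m, hm, H⟩ := G.exists_explores_iterate s' (hwc s' o') G.height
    obtain ⟨P₁, hP₁, hmem, hE₁⟩ := (H n P hE).2 (by have := hP o ho s; rwa [hoo] at this)
    obtain ⟨n₂, P₂, hP₂, hE₂, hmem₂, hn₂⟩ := G.exists_explores_star (fun s => hwc s o')
      (fun s s' => hww s s' o') hE₁ hmem
    refine ho' (hmax (y := insert o' K) ⟨Finset.mem_insert_of_mem hnone, n₂, P₂, hE₂, ?_, ?_⟩
      (Finset.subset_insert _ _) (Finset.mem_insert_self _ _))
    · intro o'' ho'' s''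
      rcases Finset.mem_insert.1 ho'' with rfl | ho''
      exacts [hmem₂ s'', hP₂ (hP₁ (hP o'' ho'' s''))]
    · rw [Finset.sum_insert ho']
      have h1 : G.pot s' (f s' o') - G.pot s' (w s' o') ≤
          ∑ s, (G.pot s (f s o') - G.pot s (w s o')) :=
        Finset.single_le_sum (f := fun s => G.pot s (f s o') - G.pot s (w s o'))
          (fun s _ => hnn s o') (Finset.mem_univ s')
      have h2 : cost o' = ∑ s, (G.pot s (f s o') - G.pot s (w s o')) +
          ∑ s, (G.pot s (f s o') - G.pot s (w s o') + G.gain) := by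
        rw [← Finset.sum_add_distrib]
        exact Finset.sum_congr rfl fun s _ => by ring
      push_cast at hn₂
      rw [h2]
      change G.gain * m ≤ G.pot s' (f s' o') - G.pot s' (w s' o') at hm
      change _ ≤ _ + ∑ s, (G.pot s (f s o') - G.pot s (w s o') + G.gain) at hn₂
      linarith
  let s₀ : ι := Classical.arbitrary ι
  have himage : ∀ s, K.image (f s) = K.image (f s₀) := by
    have hsub : ∀ s s', K.image (f s) ⊆ K.image (f s') := by
      intro s s' x hx
      obtain ⟨o, ho, rfl⟩ := Finset.mem_image.1 hx
      have : f s o ∈ Set.range (f s') := by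
        change _ ∈ Set.range (fun o => G.terminal s' (w s' o))
        rw [(hB s').2, ← (hB s).2]
        exact ⟨o, rfl⟩
      obtain ⟨o', ho'⟩ := this
      exact Finset.mem_image.2 ⟨o', hclosed o ho s o' s' ho'.symm, ho'⟩
    exact fun s => (hsub s s₀).antisymm (hsub s₀ s)
  have hcard : (K.image (f s₀)).card = K.card := Finset.card_image_of_injective _ (hB s₀).1
  -- Every charge reaches the same seeds from `K`, each exactly once, so the sum regroups by seed.
  have hsum : ∑ o ∈ K, ∑ s, G.pot s (f s o) = 0 := by
    rw [Finset.sum_comm]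
    have : ∀ s, ∑ o ∈ K, G.pot s (f s o) = ∑ b ∈ K.image (f s₀), G.pot s b := fun s => by
      rw [← himage s, Finset.sum_image fun _ _ _ _ h => (hB s).1 h]
    rw [Finset.sum_congr rfl fun s _ => this s, Finset.sum_comm]
    exact Finset.sum_eq_zero fun b _ => G.sum_pot b
  -- If all entries of a row were equal this sum would vanish; they are equal or adjacent, so it
  -- changes by at most `bound` per charge.
  have hrow : ∀ o, -∑ s, G.pot s (w s o) ≤ Fintype.card ι * G.bound := by
    intro o
    have h1 : -∑ s, G.pot s (w s o) = ∑ s, (G.pot s (w s₀ o) - G.pot s (w s o)) := by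
      rw [Finset.sum_sub_distrib, G.sum_pot, zero_sub]
    rw [h1]
    refine (Finset.sum_le_sum (g := fun _ => G.bound) fun s _ => ?_).trans_eq (by simp)
    rcases hww s₀ s o with h | h
    · rw [h, sub_self]; exact G.bound_nonneg
    · rw [← map_sub]
      exact (le_abs_self _).trans (G.pot_le s _ h)
  refine ⟨n, K.image (f s₀), ?_, ?_, ?_, ?_⟩
  · rw [hcard]
    exact Finset.card_pos.2 ⟨_, hnone⟩
  · intro x hx
    obtain ⟨o, -, rfl⟩ := Finset.mem_image.1 (Finset.mem_coe.1 hx)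
    exact G.terminal_mem_seeds s₀ (hwc s₀ o)
  · obtain ⟨l, hl, hlen, hl'⟩ := hE
    refine ⟨l, hl, hlen, fun p hp => hl' p ?_⟩
    obtain ⟨o, ho, rfl⟩ := Finset.mem_image.1 (Finset.mem_coe.1 hp)
    exact hP o ho s₀
  · have hcost : ∀ o, cost o = 2 * ∑ s, G.pot s (f s o) + 2 * -∑ s, G.pot s (w s o) +
        Fintype.card ι * G.gain := by
      intro o
      simp only [cost, Finset.sum_add_distrib, ← Finset.mul_sum, Finset.sum_sub_distrib,
        Finset.sum_const, Finset.card_univ, nsmul_eq_mul]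
      ring
    calc G.gain * n ≤ ∑ o ∈ K, cost o := hn
      _ ≤ ∑ o ∈ K, (2 * ∑ s, G.pot s (f s o) + Fintype.card ι * (2 * G.bound + G.gain)) := by
          refine Finset.sum_le_sum fun o _ => ?_
          rw [hcost]
          linarith [hrow o]
      _ = _ := by
          rw [Finset.sum_add_distrib, ← Finset.mul_sum, hsum, hcard]
          simp

end ArrowSystem

/-! ### The product measure and the union bound over walks. -/

instance (p : I) : IsProbabilityMeasure (law p) := by
  unfold law; infer_instance

lemma law_subset (p : I) (B : Finset Site) :
    law p {A | (B : Set Site) ⊆ A} = (toNNReal p : ENNReal) ^ B.card := by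
  unfold law
  rw [setBernoulli_apply']
  have : (fun p : Site → Prop ↦ {i | p i}) ⁻¹' {A | (B : Set Site) ⊆ A} =
      (B : Set Site).pi fun _ => {True} := by
    ext q
    simp [Set.subset_def, Set.mem_pi]
  rw [this, Measure.infinitePi_pi _ (fun _ _ => MeasurableSet.singleton _)]
  simp [Finset.prod_const]

lemma law_disjoint (p : I) (B : Finset Site) :
    law p {A | ∀ x ∈ B, x ∉ A} = (toNNReal (σ p) : ENNReal) ^ B.card := by
  unfold law
  rw [setBernoulli_apply']
  have : (fun p : Site → Prop ↦ {i | p i}) ⁻¹' {A | ∀ x ∈ B, x ∉ A} =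
      (B : Set Site).pi fun _ => {False} := by
    ext q
    simp [Set.mem_pi]
  rw [this, Measure.infinitePi_pi _ (fun _ _ => MeasurableSet.singleton _)]
  simp [Finset.prod_const]

/-- Union bound over walks. -/
lemma law_le_of_explores {S : Finset Site} (h0 : (0 : Site) ∈ S) {N : ℕ} {p : I} {E : Set (Set Site)}
    (hE : ∀ A ∈ E, ∃ (n : ℕ) (B : Finset Site), 1 ≤ B.card ∧ (B : Set Site) ⊆ A ∧
      Explores (S : Set Site) n B ∧ 2 * n ≤ N * B.card) :
    law p E ≤ ∑' k : ℕ, ((2 * (2 * S.card) ^ N : ℕ) * (toNNReal p : ENNReal)) ^ (k + 1) := by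
  classical
  let visited : (k : ℕ) → (Fin (N * k) → S) → Finset ℕ → Finset Site := fun k g J =>
    J.image fun j => ((List.ofFn fun i => (g i : Site)).take j).sum
  have hcover : E ⊆ ⋃ k : ℕ, ⋃ g : Fin (N * (k + 1)) → S,
      ⋃ J ∈ (Finset.range (N * (k + 1) + 1)).powerset,
        {A : Set Site | (visited (k + 1) g J).card = k + 1 ∧
          ((visited (k + 1) g J : Finset Site) : Set Site) ⊆ A} := by
    intro A hA
    obtain ⟨n, B, hB1, hBA, ⟨l, hl, hlen, hlB⟩, hn⟩ := hE A hA
    obtain ⟨k, hk⟩ : ∃ k, B.card = k + 1 := ⟨B.card - 1, by omega⟩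
    -- Zero steps pad the walk to a length depending only on `k`; the set `J` below marks the times
    -- at which it is in `B`, so `B` is recovered from the walk and `J`.
    let l' := l ++ List.replicate (N * (k + 1) - 2 * n) 0
    have hlen' : l'.length = N * (k + 1) := by
      rw [hk] at hn
      simp only [l', List.length_append, List.length_replicate, hlen]
      omega
    have hl' : ∀ d ∈ l', d ∈ S := by
      intro d hd
      rcases List.mem_append.1 hd with hd | hd
      · exact hl d hd
      · rw [List.eq_of_mem_replicate hd]; exact h0
    let g : Fin (N * (k + 1)) → S := fun i => ⟨l'.get (i.cast hlen'.symm), hl' _ (List.get_mem _ _)⟩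
    have hg : (List.ofFn fun i => (g i : Site)) = l' := by
      apply List.ext_get
      · simp [hlen']
      · intro m h1 h2
        simp [g]
    let J := (Finset.range (N * (k + 1) + 1)).filter fun j => (l'.take j).sum ∈ B
    have hJ : visited (k + 1) g J = B := by
      ext x
      simp only [visited, hg, Finset.mem_image, J, Finset.mem_filter, Finset.mem_range]
      constructor
      · rintro ⟨j, ⟨-, hj⟩, rfl⟩
        exact hj
      · intro hx
        obtain ⟨l₁, hl₁, rfl⟩ := hlB x (Finset.mem_coe.2 hx)
        have hp : l₁ <+: l' := hl₁.trans (List.prefix_append _ _)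
        have ht : l'.take l₁.length = l₁ := (List.prefix_iff_eq_take.1 hp).symm
        have := hp.length_le
        exact ⟨l₁.length, ⟨by omega, by rwa [ht]⟩, by rw [ht]⟩
    simp only [Set.mem_iUnion]
    exact ⟨k, g, J, Finset.mem_powerset.2 (Finset.filter_subset _ _),
      by rw [hJ]; exact ⟨hk, hBA⟩⟩
  refine (measure_mono hcover).trans ((measure_iUnion_le _).trans (ENNReal.tsum_le_tsum fun k => ?_))
  have hone : ∀ g : Fin (N * (k + 1)) → S, ∀ J : Finset ℕ,
      law p {A : Set Site | (visited (k + 1) g J).card = k + 1 ∧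
          ((visited (k + 1) g J : Finset Site) : Set Site) ⊆ A} ≤
        (toNNReal p : ENNReal) ^ (k + 1) := by
    intro g J
    by_cases h : (visited (k + 1) g J).card = k + 1
    · simp only [h, true_and]
      rw [law_subset, h]
    · simp [h]
  calc law p _ ≤ ∑ g : Fin (N * (k + 1)) → S, law p _ := measure_iUnion_fintype_le _ _
    _ ≤ ∑ _g : Fin (N * (k + 1)) → S, ∑ _J ∈ (Finset.range (N * (k + 1) + 1)).powerset,
          (toNNReal p : ENNReal) ^ (k + 1) :=
        Finset.sum_le_sum fun g _ => (measure_biUnion_finset_le _ _).trans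
          (Finset.sum_le_sum fun J _ => hone g J)
    _ = ((S.card ^ (N * (k + 1)) * 2 ^ (N * (k + 1) + 1) : ℕ) : ENNReal) *
          (toNNReal p : ENNReal) ^ (k + 1) := by
        simp only [Finset.sum_const, Finset.card_powerset, Finset.card_range, Finset.card_univ,
          Fintype.card_fun, Fintype.card_coe, Fintype.card_fin, nsmul_eq_mul]
        push_cast
        ring
    _ ≤ _ := by
        rw [mul_pow]
        gcongr
        rw [← Nat.cast_pow, Nat.cast_le]
        calc S.card ^ (N * (k + 1)) * 2 ^ (N * (k + 1) + 1)
            = 2 * ((2 * S.card) ^ N) ^ (k + 1) := by rw [← pow_mul, mul_pow, pow_succ]; ring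
          _ ≤ 2 ^ (k + 1) * ((2 * S.card) ^ N) ^ (k + 1) :=
              Nat.mul_le_mul_right _ (Nat.le_self_pow (by omega) 2)
          _ = _ := (mul_pow _ _ _).symm

/-! ### The closure, and eroders as a source of arrow systems. -/

lemma infected_mono (U : UpdateFamily) (A : Set Site) : Monotone (infected U A) :=
  monotone_nat_of_le_succ fun _ => Set.subset_union_left

lemma subset_closure (U : UpdateFamily) (A : Set Site) : A ⊆ closure U A :=
  Set.subset_iUnion (infected U A) 0

lemma closure_subset_of_step {U : UpdateFamily} {A C : Set Site} (hA : A ⊆ C)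
    (hC : ∀ x ∉ C, ∀ X ∈ U.rules, ∃ y ∈ X, y + x ∉ C) : closure U A ⊆ C := by
  refine Set.iUnion_subset fun t => ?_
  induction t with
  | zero => exact hA
  | succ t ih =>
    rintro x (hx | ⟨X, hX, hx⟩)
    · exact ih hx
    · by_contra hxC
      obtain ⟨y, hy, hyC⟩ := hC x hxC X hX
      exact hyC (ih (hx y hy))

/-- Rules are finite, so a rule infected eventually is infected at one common time. -/
lemma exists_notMem_closure {U : UpdateFamily} {A : Set Site} {x : Site} (hx : x ∉ closure U A)
    {X : Finset Site} (hX : X ∈ U.rules) : ∃ y ∈ X, y + x ∉ closure U A := by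
  by_contra! h
  have : ∀ y : Site, ∃ t, y ∈ X → y + x ∈ infected U A t := by
    intro y
    by_cases hy : y ∈ X
    · obtain ⟨t, ht⟩ := Set.mem_iUnion.1 (h y hy)
      exact ⟨t, fun _ => ht⟩
    · exact ⟨0, fun h => absurd h hy⟩
  choose t ht using this
  refine hx (Set.mem_iUnion.2 ⟨X.sup t + 1, Or.inr ⟨X, hX, fun y hy => ?_⟩⟩)
  exact infected_mono U A (Finset.le_sup hy) (ht y hy)

/-- The finite set of all sites of all update rules. -/
def UpdateFamily.sites (U : UpdateFamily) : Finset Site := U.rules.biUnion id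

lemma UpdateFamily.mem_sites {U : UpdateFamily} {X : Finset Site} (hX : X ∈ U.rules) {y : Site}
    (hy : y ∈ X) : y ∈ U.sites := Finset.mem_biUnion.2 ⟨X, hX, hy⟩

lemma UpdateFamily.ne_zero_of_mem_sites {U : UpdateFamily} {y : Site} (hy : y ∈ U.sites) :
    y ≠ 0 := by
  obtain ⟨X, hX, hy⟩ := Finset.mem_biUnion.1 hy
  rintro rfl
  exact U.zero_notMem_of_mem X hX hy

/-- Linear functionals summing to zero, each of which is positive at some site of every rule. -/
structure UpdateFamily.Eroder (U : UpdateFamily) (ι : Type) [Fintype ι] where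
  pot : ι → Site →+ ℝ
  sum_pot : ∀ v, ∑ s, pot s v = 0
  exists_pos : ∀ s, ∀ X ∈ U.rules, ∃ y ∈ X, 0 < pot s y

open Classical in
/-- The steps of the walks that explain infection: sites of the rules, their differences, and the
negatives of these. -/
noncomputable def UpdateFamily.steps (U : UpdateFamily) : Finset Site :=
  (insert 0 U.sites ×ˢ insert 0 U.sites).image fun q => q.1 - q.2

lemma UpdateFamily.sub_mem_steps {U : UpdateFamily} {x y : Site} (hx : x = 0 ∨ x ∈ U.sites)
    (hy : y = 0 ∨ y ∈ U.sites) : x - y ∈ U.steps := by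
  classical
  exact Finset.mem_image.2 ⟨(x, y), Finset.mem_product.2
    ⟨Finset.mem_insert.2 hx, Finset.mem_insert.2 hy⟩, rfl⟩

lemma UpdateFamily.neg_mem_steps {U : UpdateFamily} {d : Site} (hd : d ∈ U.steps) :
    -d ∈ U.steps := by
  classical
  obtain ⟨⟨x, y⟩, hxy, rfl⟩ := Finset.mem_image.1 hd
  rw [Finset.mem_product, Finset.mem_insert, Finset.mem_insert] at hxy
  rw [neg_sub]
  exact sub_mem_steps hxy.2 hxy.1

lemma exists_pos_le_of_pos {α : Type*} (D : Finset α) (f : α → ℝ) :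
    ∃ δ > 0, ∀ y ∈ D, 0 < f y → δ ≤ f y := by
  classical
  induction D using Finset.induction_on with
  | empty => exact ⟨1, one_pos, by simp⟩
  | insert a D _ ih =>
    obtain ⟨δ, hδ, h⟩ := ih
    by_cases ha : 0 < f a
    · refine ⟨min δ (f a), lt_min hδ ha, fun y hy hpos => ?_⟩
      rcases Finset.mem_insert.1 hy with rfl | hy
      exacts [min_le_right _ _, (min_le_left _ _).trans (h y hy hpos)]
    · refine ⟨δ, hδ, fun y hy hpos => ?_⟩
      rcases Finset.mem_insert.1 hy with rfl | hy
      exacts [absurd hpos ha, h y hy hpos]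

variable {U : UpdateFamily} {ι : Type} [Fintype ι]

/-- Every infected site is explained by a walk that visits a number of initially infected sites
proportional to its length. -/
lemma UpdateFamily.Eroder.exists_explores [Nonempty ι] (P : U.Eroder ι) : ∃ N : ℕ, ∀ A : Set Site,
    0 ∈ closure U A → ∃ (n : ℕ) (B : Finset Site), 1 ≤ B.card ∧ (B : Set Site) ⊆ A ∧
      Explores (U.steps : Set Site) n B ∧ 2 * n ≤ N * B.card := by
  classical
  obtain ⟨δ, hδ, hgain⟩ := exists_pos_le_of_pos (Finset.univ ×ˢ U.sites) fun q => P.pot q.1 q.2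
  let bound : ℝ := ∑ s, ∑ d ∈ U.steps, |P.pot s d|
  have hbound : ∀ s, ∀ d ∈ U.steps, |P.pot s d| ≤ bound := fun s d hd =>
    (Finset.single_le_sum (f := fun d => |P.pot s d|) (fun _ _ => abs_nonneg _) hd).trans
      (Finset.single_le_sum (f := fun s => ∑ d ∈ U.steps, |P.pot s d|)
        (fun _ _ => Finset.sum_nonneg fun _ _ => abs_nonneg _) (Finset.mem_univ s))
  let c : ℝ := Fintype.card ι * (2 * bound + δ)
  refine ⟨⌈2 * c / δ⌉₊, fun A hA => ?_⟩
  obtain ⟨T, hT⟩ := Set.mem_iUnion.1 hA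
  -- The infection time; its default value `0` at sites never infected plays no role on the carrier.
  let rank : Site → ℕ := fun v => sInf {t | v ∈ infected U A t}
  have hrank : ∀ v t, v ∈ infected U A t → rank v ≤ t := fun v t h => Nat.sInf_le h
  have hchild : ∀ s v, ∃ v', v ∈ infected U A T → v ∉ A → v' ∈ infected U A T ∧
      rank v' < rank v ∧ v' - v ∈ U.sites ∧ δ ≤ P.pot s v' - P.pot s v := by
    intro s v
    by_cases hv : v ∈ infected U A T ∧ v ∉ A
    swap
    · exact ⟨v, fun h h' => absurd ⟨h, h'⟩ hv⟩
    have hmem : v ∈ infected U A (rank v) := Nat.sInf_mem (s := {t | v ∈ infected U A t}) ⟨T, hv.1⟩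
    have hle := hrank v T hv.1
    obtain ⟨t, ht⟩ : ∃ t, rank v = t + 1 := by
      refine Nat.exists_eq_succ_of_ne_zero fun h => hv.2 ?_
      rwa [h] at hmem
    rw [ht] at hmem hle
    rcases hmem with hmem | ⟨X, hX, hmem⟩
    · have := hrank v t hmem
      omega
    obtain ⟨y, hy, hpos⟩ := P.exists_pos s X hX
    refine ⟨y + v, fun _ _ => ⟨infected_mono U A (by omega) (hmem y hy), ?_, ?_, ?_⟩⟩
    · have := hrank _ _ (hmem y hy)
      omega
    · simpa using U.mem_sites hX hy
    · rw [map_add, add_sub_cancel_right]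
      exact hgain (s, y) (by simpa using U.mem_sites hX hy) hpos
  choose child hchild using hchild
  let next : ι → Site → Site := fun s v => if v ∈ infected U A T ∧ v ∉ A then child s v else v
  have hseed : ∀ s, ∀ v ∈ A, next s v = v := fun s v hv => if_neg fun h => h.2 hv
  have hnext : ∀ s v, v ∈ infected U A T → v ∉ A → next s v = child s v :=
    fun s v h h' => if_pos ⟨h, h'⟩
  have hsub : ∀ s, ∀ v ∈ infected U A T, next s v - v = 0 ∨ next s v - v ∈ U.sites := by
    intro s v hv
    by_cases h : v ∈ A
    · exact Or.inl (by rw [hseed s v h, sub_self])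
    · exact Or.inr (by rw [hnext s v hv h]; exact (hchild s v hv h).2.2.1)
  let G : ArrowSystem Site ι :=
    { seeds := A
      carrier := infected U A T
      rank := rank
      height := T
      next := next
      steps := U.steps
      pot := P.pot
      gain := δ
      bound := bound
      rank_le := fun v hv => hrank v T hv
      next_of_seed := hseed
      next_mem := fun s v hv => by
        by_cases h : v ∈ A
        · rwa [hseed s v h]
        · rw [hnext s v hv h]
          exact (hchild s v hv h).1
      rank_next_lt := fun s v hv h => by
        rw [hnext s v hv h]
        exact (hchild s v hv h).2.1
      neg_mem := fun d hd => U.neg_mem_steps hd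
      next_sub_mem := fun s v hv => by
        simpa using U.sub_mem_steps (hsub s v hv) (Or.inl rfl)
      sibling_mem := fun s s' v hv => by
        simpa using U.sub_mem_steps (hsub s v hv) (hsub s' v hv)
      gain_pos := hδ
      gain_le := fun s v hv h => by
        rw [hnext s v hv h]
        exact (hchild s v hv h).2.2.2
      bound_nonneg := Finset.sum_nonneg fun _ _ => Finset.sum_nonneg fun _ _ => abs_nonneg _
      pot_le := hbound
      sum_pot := P.sum_pot }
  obtain ⟨n, B, hB, hBA, hE, hn⟩ := G.exists_explores_seeds hT
  refine ⟨n, B, hB, hBA, hE, ?_⟩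
  have hn' : δ * n ≤ B.card * c := hn
  have h1 : (2 * n : ℝ) ≤ 2 * c / δ * B.card := by
    rw [div_mul_eq_mul_div, le_div_iff₀ hδ]
    linarith
  have h2 : (2 * n : ℝ) ≤ ⌈2 * c / δ⌉₊ * B.card :=
    h1.trans (mul_le_mul_of_nonneg_right (Nat.le_ceil _) (Nat.cast_nonneg _))
  exact_mod_cast h2

/-- The probability of infecting the origin is at most linear in the density, up to the denominator
of a geometric series. -/
lemma UpdateFamily.Eroder.exists_law_le [Nonempty ι] (P : U.Eroder ι) : ∃ M : ℕ, ∀ p : I,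
    law p {A | (0 : Site) ∈ closure U A} ≤
      (M * (toNNReal p : ENNReal)) * (1 - M * (toNNReal p : ENNReal))⁻¹ := by
  obtain ⟨N, hN⟩ := P.exists_explores
  have h0 : (0 : Site) ∈ U.steps := by
    simpa using U.sub_mem_steps (x := 0) (y := 0) (Or.inl rfl) (Or.inl rfl)
  refine ⟨2 * (2 * U.steps.card) ^ N, fun p => (law_le_of_explores h0 hN).trans_eq ?_⟩
  simp_rw [pow_succ']
  rw [ENNReal.tsum_mul_left, ENNReal.tsum_geometric]

lemma tendsto_toNNReal_zero : Tendsto (fun p : I => (toNNReal p : ENNReal)) (𝓝 0) (𝓝 0) := by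
  have : Continuous fun p : I => (toNNReal p : ENNReal) := by
    refine ENNReal.continuous_coe.comp ?_
    fun_prop
  simpa using this.tendsto 0

lemma UpdateFamily.Eroder.tendsto_law [Nonempty ι] (P : U.Eroder ι) :
    Tendsto (fun p : I => law p {A | (0 : Site) ∈ closure U A}) (𝓝 0) (𝓝 0) := by
  obtain ⟨M, hM⟩ := P.exists_law_le
  refine tendsto_of_tendsto_of_tendsto_of_le_of_le tendsto_const_nhds ?_ (fun _ => zero_le) hM
  have h1 : Tendsto (fun p : I => M * (toNNReal p : ENNReal)) (𝓝 0) (𝓝 0) := by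
    simpa using ENNReal.Tendsto.const_mul (a := (M : ENNReal)) tendsto_toNNReal_zero
      (Or.inr (ENNReal.natCast_ne_top M))
  have h2 : Tendsto (fun p : I => (1 - M * (toNNReal p : ENNReal))⁻¹) (𝓝 0) (𝓝 1) := by
    have := (ENNReal.Tendsto.sub (tendsto_const_nhds (x := (1 : ENNReal))) h1
      (Or.inl ENNReal.one_ne_top))
    simpa using tendsto_inv_iff.2 this
  simpa using ENNReal.Tendsto.mul h1 (Or.inr ENNReal.one_ne_top) h2 (Or.inr ENNReal.zero_ne_top)

/-! ### Geometry of the stable set: subcritical families have eroders. -/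

lemma toPlane_add (x y : Site) : toPlane (x + y) = toPlane x + toPlane y := by
  ext i; simp [toPlane]

lemma toPlane_zero : toPlane 0 = 0 := by
  ext i; simp [toPlane]

lemma toPlane_injective : Function.Injective toPlane := by
  intro x y h
  ext i
  have := congrArg (fun v : EuclideanSpace ℝ (Fin 2) => v i) h
  simpa [toPlane] using this

lemma inner_toPlane (x : Site) (v : EuclideanSpace ℝ (Fin 2)) :
    inner ℝ (toPlane x) v = x 0 * v 0 + x 1 * v 1 := by
  simp [toPlane, PiLp.inner_apply, Fin.sum_univ_two, mul_comm]

/-- If a rule lies in the open half-plane, it infects the origin in one step. Otherwise the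
half-plane is closed under every rule by linearity. -/
lemma mem_stableSet_iff {U : UpdateFamily} {u : Circle} :
    u ∈ stableSet U ↔
      ∀ X ∈ U.rules, ∃ y ∈ X, 0 ≤ inner ℝ (toPlane y) (u : EuclideanSpace ℝ (Fin 2)) := by
  constructor
  · intro hu X hX
    by_contra! h
    have h0 : (0 : Site) ∈ closure U (halfPlane u) := by
      refine Set.mem_iUnion.2 ⟨1, Or.inr ⟨X, hX, fun y hy => ?_⟩⟩
      rw [add_zero]
      exact h y hy
    rw [show closure U (halfPlane u) = halfPlane u from hu] at h0
    simp [halfPlane, toPlane_zero] at h0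
  · intro h
    refine Set.Subset.antisymm (closure_subset_of_step subset_rfl fun x hx X hX => ?_)
      (subset_closure _ _)
    obtain ⟨y, hy, hpos⟩ := h X hX
    refine ⟨y, hy, fun hyx => hx ?_⟩
    simp only [halfPlane, Set.mem_ofPred_eq, toPlane_add, inner_add_left] at hyx ⊢
    linarith

/-- The vectors `v` such that every rule has a site strictly inside the half-plane in
direction `v`. -/
def UpdateFamily.blockingCone (U : UpdateFamily) : Set (EuclideanSpace ℝ (Fin 2)) :=
  {v | ∀ X ∈ U.rules, ∃ y ∈ X, 0 < inner ℝ (toPlane y) v}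

lemma UpdateFamily.isOpen_blockingCone (U : UpdateFamily) : IsOpen U.blockingCone := by
  have : U.blockingCone =
      ⋂ X ∈ U.rules, ⋃ y ∈ X, {v | 0 < inner ℝ (toPlane y) v} := by
    ext v; simp [blockingCone]
  rw [this]
  refine isOpen_biInter_finset fun X _ => isOpen_biUnion fun y _ => ?_
  exact isOpen_lt continuous_const (by fun_prop)

lemma sq_add_sq_eq_one (v : Circle) : v.1 0 ^ 2 + v.1 1 ^ 2 = 1 := by
  have := v.2
  rw [mem_sphere_zero_iff_norm, EuclideanSpace.norm_eq, Real.sqrt_eq_one] at this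
  simpa [Fin.sum_univ_two] using this

/-- The point of the unit circle in direction `v + t v'`, where `v'` is `v` rotated by a right
angle. -/
noncomputable def perturb (v : Circle) (t : ℝ) : Circle :=
  ⟨(√(1 + t ^ 2))⁻¹ • ((v : EuclideanSpace ℝ (Fin 2)) + t • !₂[-v.1 1, v.1 0]), by
    have hv := sq_add_sq_eq_one v
    have hn : ‖(v : EuclideanSpace ℝ (Fin 2)) + t • !₂[-v.1 1, v.1 0]‖ = √(1 + t ^ 2) := by
      rw [EuclideanSpace.norm_eq]
      congr 1
      simp only [Fin.sum_univ_two, Real.norm_eq_abs, sq_abs]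
      simp
      linear_combination (1 + t ^ 2) * hv
    have hp : 0 < √(1 + t ^ 2) := Real.sqrt_pos.2 (by positivity)
    rw [mem_sphere_zero_iff_norm, norm_smul, hn, norm_inv, Real.norm_of_nonneg hp.le,
      inv_mul_cancel₀ hp.ne']⟩

lemma continuous_perturb (v : Circle) : Continuous (perturb v) := by
  have h1 : Continuous fun t : ℝ => (√(1 + t ^ 2))⁻¹ :=
    Continuous.inv₀ (by fun_prop) fun t => (Real.sqrt_pos.2 (by positivity)).ne'
  have h2 : Continuous fun t : ℝ =>
      (v : EuclideanSpace ℝ (Fin 2)) + t • !₂[-v.1 1, v.1 0] := by fun_prop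
  exact Continuous.subtype_mk (h1.smul h2) _

lemma perturb_zero (v : Circle) : perturb v 0 = v := by
  ext i; simp [perturb]

/-- A nonzero `y` orthogonal to `v` is not orthogonal to the rotated vector, so any `t ≠ 0` works;
if `y` is not orthogonal to `v`, continuity suffices. -/
lemma eventually_inner_perturb_ne_zero (v : Circle) {y : Site} (hy : y ≠ 0) :
    ∀ᶠ t in 𝓝[≠] (0 : ℝ),
      inner ℝ (toPlane y) (perturb v t : EuclideanSpace ℝ (Fin 2)) ≠ 0 := by
  by_cases h : inner ℝ (toPlane y) (v : EuclideanSpace ℝ (Fin 2)) = 0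
  · filter_upwards [self_mem_nhdsWithin] with t ht h0
    have hv := sq_add_sq_eq_one v
    have hp : (√(1 + t ^ 2))⁻¹ ≠ 0 := inv_ne_zero (Real.sqrt_pos.2 (by positivity)).ne'
    have h1 : inner ℝ (toPlane y) (!₂[-v.1 1, v.1 0] : EuclideanSpace ℝ (Fin 2)) = 0 := by
      simp only [perturb, inner_smul_right, inner_add_right, h, zero_add] at h0
      simpa [hp, show t ≠ 0 from ht] using h0
    rw [inner_toPlane] at h h1
    simp only [Matrix.cons_val_zero, Matrix.cons_val_one] at h1
    refine hy (funext fun i => ?_)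
    have : (y i : ℝ) = 0 := by
      fin_cases i
      · simp only [Fin.zero_eta]
        linear_combination v.1 0 * h - v.1 1 * h1 - (y 0 : ℝ) * hv
      · simp only [Fin.mk_one]
        linear_combination v.1 1 * h + v.1 0 * h1 - (y 1 : ℝ) * hv
    exact_mod_cast this
  · have hc : Continuous fun t => inner ℝ (toPlane y) (perturb v t : EuclideanSpace ℝ (Fin 2)) :=
      continuous_const.inner (continuous_subtype_val.comp (continuous_perturb v))
    exact (hc.continuousAt.eventually_ne (by simpa [perturb_zero] using h)).filter_mono
      nhdsWithin_le_nhds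

/-- Stability gives only weak inequalities. A small rotation inside the interior of the stable set
avoids orthogonality to the finitely many rule sites and makes them strict. -/
lemma UpdateFamily.IsSubcritical.exists_mem_blockingCone {U : UpdateFamily} (hU : U.IsSubcritical)
    (w : Circle) : ∃ u ∈ U.blockingCone, 0 < inner ℝ u (w : EuclideanSpace ℝ (Fin 2)) := by
  obtain ⟨v, hvw, hvS⟩ := hU w
  have hO : IsOpen (openSemicircle w ∩ interior (stableSet U)) := by
    refine IsOpen.inter (isOpen_lt continuous_const ?_) isOpen_interior
    exact continuous_subtype_val.inner continuous_const
  have h1 : ∀ᶠ t in 𝓝[≠] (0 : ℝ), perturb v t ∈ openSemicircle w ∩ interior (stableSet U) :=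
    ((continuous_perturb v).continuousAt.eventually_mem
      (hO.mem_nhds (by rw [perturb_zero]; exact ⟨hvw, hvS⟩))).filter_mono nhdsWithin_le_nhds
  have h2 : ∀ᶠ t in 𝓝[≠] (0 : ℝ), ∀ y ∈ U.sites,
      inner ℝ (toPlane y) (perturb v t : EuclideanSpace ℝ (Fin 2)) ≠ 0 :=
    (Filter.eventually_all_finset _).2 fun y hy =>
      eventually_inner_perturb_ne_zero v (U.ne_zero_of_mem_sites hy)
  obtain ⟨t, ⟨ht, htS⟩, ht2⟩ := (h1.and h2).exists
  refine ⟨perturb v t, fun X hX => ?_, ht⟩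
  obtain ⟨y, hy, hpos⟩ := mem_stableSet_iff.1 (interior_subset htS) X hX
  exact ⟨y, hy, lt_of_le_of_ne hpos (ht2 y (U.mem_sites hX hy)).symm⟩

/-- The normalisation of a nonzero vector. -/
noncomputable def normalize (z : EuclideanSpace ℝ (Fin 2)) (hz : z ≠ 0) : Circle :=
  ⟨‖z‖⁻¹ • z, by
    rw [mem_sphere_zero_iff_norm, norm_smul, norm_inv, norm_norm,
      inv_mul_cancel₀ (norm_ne_zero_iff.2 hz)]⟩

lemma inner_normalize (x z : EuclideanSpace ℝ (Fin 2)) (hz : z ≠ 0) :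
    inner ℝ x (normalize z hz : EuclideanSpace ℝ (Fin 2)) = ‖z‖⁻¹ * inner ℝ x z := by
  simp [normalize, inner_smul_right]

/-- Otherwise a vector `z` separates the origin from the cone, and the open semicircle centred at
`z` yields a blocking vector on the wrong side. -/
lemma UpdateFamily.IsSubcritical.zero_mem_convexHull {U : UpdateFamily} (hU : U.IsSubcritical) :
    0 ∈ convexHull ℝ U.blockingCone := by
  by_contra h
  obtain ⟨f, hf⟩ := geometric_hahn_banach_open_point (convex_convexHull ℝ _)
    U.isOpen_blockingCone.convexHull h
  let z := (InnerProductSpace.toDual ℝ (EuclideanSpace ℝ (Fin 2))).symm f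
  have hz : ∀ u, inner ℝ z u = f u := fun u => InnerProductSpace.toDual_symm_apply
  -- An arbitrary direction, used only to see that the cone is non-empty and hence `z ≠ 0`.
  have he : (EuclideanSpace.single 0 1 : EuclideanSpace ℝ (Fin 2)) ≠ 0 := by simp
  have hlt : ∀ u ∈ U.blockingCone, inner ℝ u z < 0 := fun u hu => by
    rw [real_inner_comm, hz]
    simpa using hf u (subset_convexHull ℝ _ hu)
  have hz0 : z ≠ 0 := by
    intro h0
    obtain ⟨u, hu, -⟩ := hU.exists_mem_blockingCone (normalize _ he)
    simpa [h0] using hlt u hu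
  obtain ⟨u, hu, hpos⟩ := hU.exists_mem_blockingCone (normalize z hz0)
  rw [inner_normalize] at hpos
  have := hlt u hu
  have hn : 0 < ‖z‖⁻¹ := inv_pos.2 (norm_pos_iff.2 hz0)
  nlinarith

lemma UpdateFamily.IsSubcritical.exists_eroder {U : UpdateFamily} (hU : U.IsSubcritical) :
    ∃ (ι : Type) (_ : Fintype ι) (_ : Nonempty ι), Nonempty (U.Eroder ι) := by
  classical
  obtain ⟨κ, _, c, z, hc, hc1, hz, hsum⟩ :=
    mem_convexHull_iff_exists_fintype.1 hU.zero_mem_convexHull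
  -- Zero weights are dropped: the scaled potentials must be strictly positive somewhere on each
  -- rule.
  let J : Finset κ := Finset.univ.filter fun i => c i ≠ 0
  have hJ : ∑ s : J, c s • z s = 0 := by
    rw [Finset.sum_coe_sort J fun s => c s • z s, ← hsum]
    exact Finset.sum_subset (Finset.subset_univ _) fun i _ hi => by
      have : c i = 0 := by simpa [J] using hi
      rw [this, zero_smul]
  have hne : J.Nonempty := by
    by_contra h
    rw [Finset.not_nonempty_iff_eq_empty] at h
    have : ∀ i, c i = 0 := fun i => by
      by_contra hi
      have : i ∈ J := by simp [J, hi]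
      simp [h] at this
    simp [this] at hc1
  refine ⟨J, inferInstance, hne.to_subtype, ⟨?_⟩⟩
  exact
    { pot := fun s =>
        { toFun := fun x => inner ℝ (toPlane x) (c s • z s)
          map_zero' := by rw [toPlane_zero, inner_zero_left]
          map_add' := fun x y => by rw [toPlane_add, inner_add_left] }
      sum_pot := fun v => by
        change ∑ s : J, inner ℝ (toPlane v) (c s • z s) = 0
        rw [← inner_sum, hJ, inner_zero_right]
      exists_pos := fun s X hX => by
        obtain ⟨y, hy, hpos⟩ := hz s X hX
        refine ⟨y, hy, ?_⟩
        have hs : c s ≠ 0 := (Finset.mem_filter.1 s.2).2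
        change 0 < inner ℝ (toPlane y) (c s • z s)
        rw [inner_smul_right]
        exact mul_pos (lt_of_le_of_ne (hc s) hs.symm) hpos }

/-! ### Positivity of the critical probability. -/

lemma ae_closure_one : ∀ᵐ A ∂(law 1), closure U A = Set.univ := by
  have : ∀ᵐ A ∂(law 1), ∀ x : Site, x ∈ A := by
    refine ae_all_iff.2 fun x => ?_
    have := law_disjoint 1 {x}
    simpa [ae_iff] using this
  filter_upwards [this] with A hA
  exact Set.eq_univ_of_forall fun x => subset_closure U A (hA x)

lemma criticalProbability_le {p : I} (hp : ∀ᵐ A ∂(law p), closure U A = Set.univ) :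
    criticalProbability U ≤ p :=
  csInf_le ⟨0, by rintro _ ⟨q, rfl, -⟩; exact q.2.1⟩ ⟨p, rfl, hp⟩

lemma le_criticalProbability {q : ℝ}
    (h : ∀ p : I, (∀ᵐ A ∂(law p), closure U A = Set.univ) → q ≤ p) :
    q ≤ criticalProbability U :=
  le_csInf ⟨1, 1, rfl, ae_closure_one⟩ (by rintro _ ⟨p, rfl, hp⟩; exact h p hp)

lemma criticalProbability_pos
    (h : Tendsto (fun p : I => law p {A | (0 : Site) ∈ closure U A}) (𝓝 0) (𝓝 0)) :
    0 < criticalProbability U := by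
  obtain ⟨ε, hε, H⟩ := Metric.eventually_nhds_iff.1
    (h.eventually (gt_mem_nhds (zero_lt_one (α := ENNReal))))
  refine hε.trans_le (le_criticalProbability fun p hp => ?_)
  by_contra! hlt
  have h1 := H (y := p) (by
    rw [Subtype.dist_eq, Real.dist_eq]
    simpa [abs_of_nonneg p.2.1] using hlt)
  have h2 : law p {A | (0 : Site) ∈ closure U A} = 1 := by
    refine (measure_eq_measure_of_null_sdiff (Set.subset_univ _) ?_).trans measure_univ
    refine measure_mono_null (fun A hA => ?_) hp
    intro h
    exact hA.2 (by simp [show closure U A = Set.univ from h])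
  exact h1.ne h2

/-! ### All directions stable: a finite blocking set. -/

/-- The origin lies in the convex hull of `X`: a strictly separating functional would give an
unstable direction. -/
lemma exists_balanced_of_stableSet_eq_univ (h : stableSet U = Set.univ) {X : Finset Site}
    (hX : X ∈ U.rules) : ∃ c : Site → ℝ, (∀ y ∈ X, 0 ≤ c y) ∧ (∃ y ∈ X, 0 < c y) ∧
      ∀ i, ∑ y ∈ X, c y * y i = 0 := by
  classical
  have h0 : (0 : EuclideanSpace ℝ (Fin 2)) ∈ convexHull ℝ (X.image toPlane : Set _) := by
    by_contra hn
    obtain ⟨f, a, ha, hf⟩ := geometric_hahn_banach_point_closed (convex_convexHull ℝ _)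
      ((X.image toPlane).finite_toSet.isClosed_convexHull ℝ) hn
    let z := (InnerProductSpace.toDual ℝ (EuclideanSpace ℝ (Fin 2))).symm f
    have hz : ∀ u, inner ℝ z u = f u := fun u => InnerProductSpace.toDual_symm_apply
    have hpos : ∀ y ∈ X, 0 < inner ℝ z (toPlane y) := fun y hy => by
      rw [hz]
      have := hf _ (subset_convexHull ℝ _ (Finset.mem_coe.2 (Finset.mem_image_of_mem toPlane hy)))
      rw [map_zero] at ha
      linarith
    obtain ⟨y₀, hy₀⟩ := U.nonempty_of_mem X hX
    have hz0 : -z ≠ 0 := by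
      intro h0
      have := hpos y₀ hy₀
      rw [neg_eq_zero.1 h0, inner_zero_left] at this
      exact this.false
    have hu : normalize (-z) hz0 ∈ stableSet U := h ▸ Set.mem_univ _
    obtain ⟨y, hy, hy'⟩ := mem_stableSet_iff.1 hu X hX
    rw [inner_normalize, inner_neg_right, real_inner_comm] at hy'
    have h1 := hpos y hy
    have h2 : 0 < ‖-z‖⁻¹ := inv_pos.2 (norm_pos_iff.2 hz0)
    nlinarith
  obtain ⟨w, hw, hw1, hw0⟩ := Finset.mem_convexHull'.1 h0
  rw [Finset.sum_image fun _ _ _ _ h => toPlane_injective h] at hw1 hw0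
  refine ⟨fun y => w (toPlane y), fun y hy => hw _ (Finset.mem_image_of_mem _ hy), ?_, ?_⟩
  · by_contra! hle
    have : ∑ y ∈ X, w (toPlane y) ≤ 0 := Finset.sum_nonpos hle
    linarith
  · intro i
    have := congrArg (fun v : EuclideanSpace ℝ (Fin 2) => v i) hw0
    simpa [toPlane] using this

/-- The lattice points of the zonotope spanned by the sites of all rules. -/
def UpdateFamily.zonotope (U : UpdateFamily) : Set Site :=
  {x | ∃ c : Site → ℝ, (∀ d ∈ U.sites, 0 ≤ c d ∧ c d ≤ 1) ∧
    ∀ i, ∑ d ∈ U.sites, c d * d i = x i}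

lemma UpdateFamily.zero_mem_zonotope (U : UpdateFamily) : 0 ∈ U.zonotope :=
  ⟨0, by simp, by simp⟩

lemma UpdateFamily.finite_zonotope (U : UpdateFamily) : U.zonotope.Finite := by
  refine (Set.finite_Icc (fun i => -∑ d ∈ U.sites, |d i|) fun i => ∑ d ∈ U.sites, |d i|).subset ?_
  rintro x ⟨c, hc, hx⟩
  have key : ∀ i, |x i| ≤ ∑ d ∈ U.sites, |d i| := by
    intro i
    have : |(x i : ℝ)| ≤ ∑ d ∈ U.sites, |(d i : ℝ)| := by
      rw [← hx i]
      refine (Finset.abs_sum_le_sum_abs _ _).trans (Finset.sum_le_sum fun d hd => ?_)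
      rw [abs_mul, abs_of_nonneg (hc d hd).1]
      exact mul_le_of_le_one_left (abs_nonneg _) (hc d hd).2
    exact_mod_cast this
  exact ⟨fun i => (abs_le.1 (key i)).1, fun i => (abs_le.1 (key i)).2⟩

/-- Subtracting a multiple of the balanced relation on `X` does not change the point `x`. Do so
until the coefficient of some `y ∈ X` first reaches `0`; it can then be raised to `1`, which adds
`y`. -/
lemma exists_add_mem_zonotope (h : stableSet U = Set.univ) {X : Finset Site} (hX : X ∈ U.rules)
    {x : Site} (hx : x ∈ U.zonotope) : ∃ y ∈ X, y + x ∈ U.zonotope := by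
  classical
  obtain ⟨l, hl, ⟨y₁, hy₁, hl₁⟩, hl0⟩ := exists_balanced_of_stableSet_eq_univ h hX
  obtain ⟨c, hc, hx⟩ := hx
  have hXU : X ⊆ U.sites := fun y hy => U.mem_sites hX hy
  -- The minimal ratio is the largest multiple of the relation that keeps all coefficients
  -- nonnegative.
  obtain ⟨y, hy, hmin⟩ := Finset.exists_min_image (X.filter fun y => 0 < l y) (fun y => c y / l y)
    ⟨y₁, Finset.mem_filter.2 ⟨hy₁, hl₁⟩⟩
  obtain ⟨hyX, hly⟩ := Finset.mem_filter.1 hy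
  set t := c y / l y
  have ht : 0 ≤ t := div_nonneg (hc y (hXU hyX)).1 hly.le
  let m : Site → ℝ := fun d => if d ∈ X then l d else 0
  have hm : ∀ d, 0 ≤ m d := fun d => by
    by_cases hd : d ∈ X <;> simp [m, hd, hl]
  have hm0 : ∀ i, ∑ d ∈ U.sites, m d * d i = 0 := by
    intro i
    rw [← hl0 i, ← Finset.sum_subset hXU]
    · exact Finset.sum_congr rfl fun d hd => by simp [m, hd]
    · intro d _ hd
      simp [m, hd]
  have hle : ∀ d ∈ U.sites, t * m d ≤ c d := by
    intro d hd
    by_cases hpos : d ∈ X ∧ 0 < l d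
    · have := hmin d (Finset.mem_filter.2 hpos)
      simp only [m, hpos.1, if_true]
      exact (le_div_iff₀ hpos.2).1 this
    · have : m d = 0 := by
        by_cases hdX : d ∈ X
        · simp only [m, hdX, if_true]
          exact le_antisymm (not_lt.1 fun h => hpos ⟨hdX, h⟩) (hl d hdX)
        · simp [m, hdX]
      rw [this, mul_zero]
      exact (hc d hd).1
  have hy0 : c y - t * m y = 0 := by
    simp only [m, hyX, if_true, t]
    rw [div_mul_cancel₀ _ hly.ne', sub_self]
  refine ⟨y, hyX, fun d => (c d - t * m d) + if d = y then 1 else 0, fun d hd => ?_, fun i => ?_⟩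
  · by_cases hdy : d = y
    · subst hdy
      simp [hy0]
    · have h1 := hle d hd
      have h2 := mul_nonneg ht (hm d)
      have h3 := (hc d hd).2
      simp only [hdy, if_false, add_zero]
      exact ⟨by linarith, by linarith⟩
  · simp only [add_mul, sub_mul, ite_mul, one_mul, zero_mul, Finset.sum_add_distrib,
      Finset.sum_sub_distrib, mul_assoc, ← Finset.mul_sum, hm0, hx, Finset.sum_ite_eq',
      hXU hyX, if_true]
    simp [add_comm]

/-- For `p < 1` the finite zonotope is initially healthy with positive probability, and it then
stays healthy forever. -/
lemma criticalProbability_eq_one (h : stableSet U = Set.univ) : criticalProbability U = 1 := by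
  refine le_antisymm (criticalProbability_le ae_closure_one)
    (le_criticalProbability fun p hp => ?_)
  by_contra! hlt
  have h1 := law_disjoint p U.finite_zonotope.toFinset
  have h2 : law p {A | ∀ x ∈ U.finite_zonotope.toFinset, x ∉ A} = 0 := by
    refine measure_mono_null (t := {A | ¬closure U A = Set.univ}) (fun A hA hcl => ?_)
      (ae_iff.1 hp)
    have hsub : closure U A ⊆ U.zonotopeᶜ := by
      refine closure_subset_of_step (fun x hx hz => hA x (by simpa using hz) hx) ?_
      intro x hx X hX
      obtain ⟨y, hy, hyz⟩ := exists_add_mem_zonotope h hX (not_not.1 hx)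
      exact ⟨y, hy, not_not.2 hyz⟩
    rw [show closure U A = Set.univ from hcl] at hsub
    exact hsub (Set.mem_univ 0) U.zero_mem_zonotope
  rw [h2] at h1
  have h3 : toNNReal (σ p) = 0 := by
    simpa using eq_zero_of_pow_eq_zero h1.symm
  have h4 := congrArg NNReal.toReal h3
  rw [coe_toNNReal, NNReal.coe_zero, coe_symm_eq] at h4
  linarith

/-! ### Some direction unstable: long healthy paths. -/

open Classical in
/-- The vertex sets of the paths of `n` sites that start at `x` and make steps in `X`. -/
noncomputable def pathSets (X : Finset Site) : ℕ → Site → Finset (Finset Site)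
  | 0, _ => {∅}
  | n + 1, x => X.biUnion fun y => (pathSets X n (y + x)).image (insert x)

lemma card_pathSets_le (X : Finset Site) (n : ℕ) (x : Site) :
    (pathSets X n x).card ≤ X.card ^ n := by
  classical
  induction n generalizing x with
  | zero => simp [pathSets]
  | succ n ih =>
    rw [pathSets, pow_succ, mul_comm]
    exact Finset.card_biUnion_le_card_mul _ _ _ fun y _ => Finset.card_image_le.trans (ih _)

/-- The inner product with `u` strictly decreases along the path, so no site repeats; the bound on
the inner products carries the induction. -/
lemma card_of_mem_pathSets {X : Finset Site} {u : Circle}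
    (hX : ∀ y ∈ X, inner ℝ (toPlane y) (u : EuclideanSpace ℝ (Fin 2)) < 0) (n : ℕ) (x : Site)
    {B : Finset Site} (hB : B ∈ pathSets X n x) : B.card = n ∧ ∀ b ∈ B,
      inner ℝ (toPlane b) (u : EuclideanSpace ℝ (Fin 2)) ≤ inner ℝ (toPlane x) u.1 := by
  classical
  induction n generalizing x B with
  | zero =>
    obtain rfl : B = ∅ := by simpa [pathSets] using hB
    simp
  | succ n ih =>
    simp only [pathSets, Finset.mem_biUnion, Finset.mem_image] at hB
    obtain ⟨y, hy, B, hB, rfl⟩ := hB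
    obtain ⟨hc, hb⟩ := ih (y + x) hB
    have hlt : inner ℝ (toPlane (y + x)) u.1 < inner ℝ (toPlane x) u.1 := by
      rw [toPlane_add, inner_add_left]
      linarith [hX y hy]
    refine ⟨?_, fun b hb' => ?_⟩
    · rw [Finset.card_insert_of_notMem fun h => (hb x h).not_gt hlt, hc]
    · rcases Finset.mem_insert.1 hb' with rfl | hb'
      exacts [le_rfl, (hb b hb').trans hlt.le]

lemma exists_pathSets_disjoint {X : Finset Site} (hX : X ∈ U.rules) {A : Set Site} (n : ℕ)
    {x : Site} (hx : x ∉ closure U A) : ∃ B ∈ pathSets X n x, ∀ b ∈ B, b ∉ A := by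
  classical
  induction n generalizing x with
  | zero => exact ⟨∅, by simp [pathSets], by simp⟩
  | succ n ih =>
    obtain ⟨y, hy, hyx⟩ := exists_notMem_closure hx hX
    obtain ⟨B, hB, hBA⟩ := ih hyx
    refine ⟨insert x B, ?_, ?_⟩
    · exact Finset.mem_biUnion.2 ⟨y, hy, Finset.mem_image_of_mem _ hB⟩
    · intro b hb
      rcases Finset.mem_insert.1 hb with rfl | hb
      exacts [fun h => hx (subset_closure U A h), hBA b hb]

lemma criticalProbability_lt_one (h : stableSet U ≠ Set.univ) : criticalProbability U < 1 := by
  obtain ⟨u, hu⟩ := (Set.ne_univ_iff_exists_notMem _).1 h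
  rw [mem_stableSet_iff] at hu
  push Not at hu
  obtain ⟨X, hX, hXu⟩ := hu
  have hcard : (1 : ℝ) ≤ X.card := by
    exact_mod_cast Finset.card_pos.2 (U.nonempty_of_mem X hX)
  -- The density of healthy sites, chosen so that the at most `X.card ^ n` paths contribute at most
  -- `2⁻¹ ^ n` in total.
  let q : I := ⟨(2 * X.card : ℝ)⁻¹, by positivity, inv_le_one_of_one_le₀ (by linarith)⟩
  have hq : (X.card : ENNReal) * (toNNReal q : ENNReal) = 2⁻¹ := by
    have : (X.card : NNReal) * toNNReal q = 2⁻¹ := by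
      ext
      simp only [NNReal.coe_mul, NNReal.coe_natCast, coe_toNNReal, q, NNReal.coe_inv,
        NNReal.coe_ofNat]
      field_simp
    have := congrArg ENNReal.ofNNReal this
    simpa using this
  have hae : ∀ᵐ A ∂(law (σ q)), closure U A = Set.univ := by
    have : ∀ᵐ A ∂(law (σ q)), ∀ x, x ∈ closure U A := by
      refine ae_all_iff.2 fun x => ?_
      rw [ae_iff]
      have hle : ∀ n : ℕ, law (σ q) {A | x ∉ closure U A} ≤ 2⁻¹ ^ n := by
        intro n
        calc law (σ q) {A | x ∉ closure U A}
            ≤ law (σ q) (⋃ B ∈ pathSets X n x, {A | ∀ b ∈ B, b ∉ A}) := by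
              refine measure_mono fun A hA => ?_
              obtain ⟨B, hB, hBA⟩ := exists_pathSets_disjoint hX n hA
              exact Set.mem_biUnion hB hBA
          _ ≤ ∑ B ∈ pathSets X n x, law (σ q) {A | ∀ b ∈ B, b ∉ A} :=
              measure_biUnion_finset_le _ _
          _ = ∑ _B ∈ pathSets X n x, (toNNReal q : ENNReal) ^ n :=
              Finset.sum_congr rfl fun B hB => by
                rw [law_disjoint, symm_symm, (card_of_mem_pathSets hXu n x hB).1]
          _ ≤ (X.card : ENNReal) ^ n * (toNNReal q : ENNReal) ^ n := by
              rw [Finset.sum_const, nsmul_eq_mul]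
              gcongr
              exact_mod_cast card_pathSets_le X n x
          _ = 2⁻¹ ^ n := by rw [← mul_pow, hq]
      exact le_antisymm (ge_of_tendsto' (ENNReal.tendsto_pow_atTop_nhds_zero_of_lt_one
        ENNReal.one_half_lt_one) hle) zero_le
    filter_upwards [this] with A hA
    exact Set.eq_univ_of_forall hA
  refine (criticalProbability_le hae).trans_lt ?_
  rw [coe_symm_eq]
  have : (0 : ℝ) < q := inv_pos.2 (by linarith)
  linarith

end Bootstrap

theorem theorem1 (U : Bootstrap.UpdateFamily) (hU : U.IsSubcritical) :
    Tendsto (fun p : I => Bootstrap.law p {A | (0 : Bootstrap.Site) ∈ Bootstrap.closure U A})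
        (𝓝[>] 0) (𝓝 0) ∧
      0 < Bootstrap.criticalProbability U ∧
      (Bootstrap.criticalProbability U = 1 ↔ Bootstrap.stableSet U = Set.univ) := by
  obtain ⟨ι, _, _, ⟨P⟩⟩ := hU.exists_eroder
  have ht := P.tendsto_law
  refine ⟨ht.mono_left nhdsWithin_le_nhds, Bootstrap.criticalProbability_pos ht, fun h => ?_,
    Bootstrap.criticalProbability_eq_one⟩
  by_contra hne
  exact (Bootstrap.criticalProbability_lt_one hne).ne h
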